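/- Let $\alpha,\beta,\gamma>0$ and $z\in\mathbb C\setminus\{0\}$. Let $[\Gamma(-\alpha s+\beta)]^{\gamma}$ denote the branch that is holomorphic in the $s$-plane cut along $[\beta/\alpha,+\infty)$ and positive for negative real $s$, and let $(-z)^s=\exp\{s[\log|z|+i\theta]\}$, where $\theta$ is an arbitrarily chosen value of $\arg(-z)$. Let $\mathcal L_{-\infty}$ be a left loop, that is, a piecewise $C^1$ curve situated in a horizontal strip, starting at $-\infty+i\varphi_1$, terminating at $-\infty+i\varphi_2$, with $-\infty<\varphi_1<0<\varphi_2<+\infty$, and crossing the real line only at a point $c$, $-1<c<0$. Define the extended Le Roy type function by $$\mathcal F_{-\alpha,\beta}^{(\gamma)}(z)=\frac{1}{2\pi i}\int_{\mathcal L_{-\infty}}\frac{\Gamma(-s)\,\Gamma(1+s)}{[\Gamma(-\alpha s+\beta)]^{\gamma}}\,(-z)^{s}\,ds ,$$ where the integral is the limit of the integrals over bounded pieces of the curve as the two ends of the piece tend, independently, to the two ends of the curve. Then this integral converges, the series below is absolutely convergent, and $$\mathcal F_{-\alpha,\beta}^{(\gamma)}(z)=-\sum_{k=1}^{\infty}\frac{1}{[\Gamma(\alpha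 k+\beta)]^{\gamma}}\,\frac1{z^{k}} .$$ In particular the value does not depend on the choice of the loop or of $\theta$. -/

import Mathlib

open Filter Topology

namespace LeRoy

/-- The principal branch of `log Γ` on the plane cut along `(-∞, 0]`: the primitive of the digamma
function `Γ'/Γ` along the segment from `1` to `w`, vanishing at `w = 1`
(see `exp_logGamma`, `differentiableOn_logGamma`, `logGamma_ofReal`). -/
noncomputable def logGamma (w : ℂ) : ℂ :=
  ∫ t in (0 : ℝ)..1, (w - 1) * Complex.digamma (1 + t * (w - 1))

/-- The branch of the multi-valued function `Γ(w)^γ` which is holomorphic on the plane cut along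
`(-∞, 0]` and positive for `w > 0`. For `w = -α s + β` the cut is `[β/α, +∞)` in the `s`-plane. -/
noncomputable def gammaPow (γ : ℝ) (w : ℂ) : ℂ :=
  Complex.exp (γ * logGamma w)

/-- A left loop: a continuous, piecewise `C¹` curve `ℝ → ℂ` starting at `-∞ + i φ₁`, terminating at
`-∞ + i φ₂`, and crossing the real line at the point `c` (and nowhere else). Convergence of the
imaginary part at both ends and continuity put the curve in a horizontal strip. -/
structure LeftLoop (φ₁ φ₂ c : ℝ) where
  toFun : ℝ → ℂ
  continuous_toFun : Continuous toFun
  /-- The corners of the curve. -/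
  corners : Set ℝ
  finite_corners : ∀ a b : ℝ, (corners ∩ Set.Icc a b).Finite
  contDiffOn_toFun : ∀ a b : ℝ, corners ∩ Set.Ioo a b = ∅ → ContDiffOn ℝ 1 toFun (Set.Icc a b)
  re_start : Tendsto (fun t => (toFun t).re) atBot atBot
  im_start : Tendsto (fun t => (toFun t).im) atBot (𝓝 φ₁)
  re_end : Tendsto (fun t => (toFun t).re) atTop atBot
  im_end : Tendsto (fun t => (toFun t).im) atTop (𝓝 φ₂)
  crossing : ∀ t : ℝ, (toFun t).im = 0 → toFun t = (c : ℂ)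

/-- The pull-back of `f(s) ds` to the parameter line of the loop. -/
noncomputable def LeftLoop.pullback {φ₁ φ₂ c : ℝ} (L : LeftLoop φ₁ φ₂ c) (f : ℂ → ℂ) (t : ℝ) : ℂ :=
  f (L.toFun t) * deriv L.toFun t

/-- The contour integral of `f` along the loop exists and is equal to `I`: `f` is integrable along
every bounded piece, and the integrals over the pieces converge to `I` when the two ends of the
piece tend, independently of each other, to the two ends of the loop. -/
def LeftLoop.HasIntegral {φ₁ φ₂ c : ℝ} (L : LeftLoop φ₁ φ₂ c) (f : ℂ → ℂ) (I : ℂ) : Prop :=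
  (∀ a b : ℝ, IntervalIntegrable (L.pullback f) MeasureTheory.volume a b) ∧
    Tendsto (fun p : ℝ × ℝ => ∫ t in p.1..p.2, L.pullback f t) (atBot ×ˢ atTop) (𝓝 I)

/-- The value of the (improper) contour integral of `f` along the loop. -/
noncomputable def LeftLoop.integral {φ₁ φ₂ c : ℝ} (L : LeftLoop φ₁ φ₂ c) (f : ℂ → ℂ) : ℂ :=
  limUnder (atBot ×ˢ atTop) (fun p : ℝ × ℝ => ∫ t in p.1..p.2, L.pullback f t)

/-- The integrand `Γ(-s) Γ(1+s) (-z)^s / [Γ(-α s + β)]^γ`, where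
`(-z)^s = exp (s (log |z| + i θ))` and `θ` is the chosen value of `arg (-z)`. -/
noncomputable def integrand (α β γ θ : ℝ) (z s : ℂ) : ℂ :=
  Complex.Gamma (-s) * Complex.Gamma (1 + s) / gammaPow γ (-(α * s) + β) *
    Complex.exp (s * (Real.log ‖z‖ + Complex.I * θ))

/-- The extended Le Roy type function `𝓕_{-α,β}^{(γ)}(z)`, computed with the loop `L` and the value
`θ` of `arg (-z)`. -/
noncomputable def extended {φ₁ φ₂ c : ℝ} (L : LeftLoop φ₁ φ₂ c) (α β γ θ : ℝ) (z : ℂ) : ℂ :=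
  1 / (2 * Real.pi * Complex.I) * L.integral (integrand α β γ θ z)

theorem exists_log_Gamma : ∃ f : ℂ → ℂ,
    (∀ w ∈ Complex.slitPlane, HasDerivAt f (Complex.digamma w) w) ∧
    (∀ w ∈ Complex.slitPlane, Complex.exp (f w) = Complex.Gamma w) ∧ f 1 = 0 := by
  have hG : ∀ w ∈ Complex.slitPlane, ∀ m : ℕ, w ≠ -m := by
    rintro w hw m rfl
    rw [Complex.mem_slitPlane_iff] at hw
    simp at hw
    linarith [(Nat.cast_nonneg m : (0 : ℝ) ≤ m)]
  have h1 : (1 : ℂ) ∈ Complex.slitPlane := Complex.one_mem_slitPlane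
  have hsc : IsSimplyConnected Complex.slitPlane := by
    have : ContractibleSpace Complex.slitPlane :=
      Complex.starConvex_one_slitPlane.contractibleSpace ⟨1, h1⟩
    exact (inferInstance : SimplyConnectedSpace Complex.slitPlane)
  have hd : ∀ w ∈ Complex.slitPlane, DifferentiableAt ℂ Complex.Gamma w :=
    fun w hw => Complex.differentiableAt_Gamma w (hG w hw)
  obtain ⟨f, hfc, hf⟩ := Complex.exists_continuousOn_eqOn_exp_comp hsc Complex.isOpen_slitPlane
    (g := Complex.Gamma) (fun w hw => (hd w hw).continuousAt.continuousWithinAt)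
    (by rintro ⟨w, hw, h⟩; exact Complex.Gamma_ne_zero (hG w hw) h)
  refine ⟨fun w => f w - f 1, ?_, ?_, by simp⟩
  · intro w hw
    have hev : ∀ᶠ y in 𝓝 w, y ∈ Complex.slitPlane := Complex.isOpen_slitPlane.mem_nhds hw
    have := HasDerivAt.of_comp_left (hfc.continuousAt hev) (Complex.hasDerivAt_exp (f w))
      (hd w hw).hasDerivAt (Complex.exp_ne_zero _) (hev.mono fun y hy => hf hy)
    have e2 := hf hw
    simp only [Function.comp_apply] at e2
    rw [e2] at this
    exact this.sub_const (f 1)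
  · intro w hw
    have e1 := hf h1
    have e2 := hf hw
    simp only [Function.comp_apply, Complex.Gamma_one] at e1 e2
    rw [Complex.exp_sub, e1, e2, div_one]

theorem logGamma_eq_of_primitive {f : ℂ → ℂ}
    (hf : ∀ w ∈ Complex.slitPlane, HasDerivAt f (Complex.digamma w) w) (h1 : f 1 = 0)
    {w : ℂ} (hw : w ∈ Complex.slitPlane) : logGamma w = f w := by
  have hseg : ∀ t ∈ Set.uIcc (0 : ℝ) 1, 1 + (t : ℂ) * (w - 1) ∈ Complex.slitPlane := by
    intro t ht
    rw [Set.uIcc_of_le zero_le_one] at ht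
    have := Complex.starConvex_one_slitPlane.add_smul_mem (y := w - 1) (by simpa using hw)
      ht.1 ht.2
    simpa using this
  have hdig : ContinuousOn Complex.digamma Complex.slitPlane := by
    have : Set.EqOn (deriv f) Complex.digamma Complex.slitPlane := fun y hy => (hf y hy).deriv
    refine ContinuousOn.congr ?_ this.symm
    exact (DifferentiableOn.deriv (fun y hy => (hf y hy).differentiableAt.differentiableWithinAt)
      Complex.isOpen_slitPlane).continuousOn
  have hder : ∀ t ∈ Set.uIcc (0 : ℝ) 1, HasDerivAt (fun t : ℝ => f (1 + t * (w - 1)))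
      ((w - 1) * Complex.digamma (1 + t * (w - 1))) t := by
    intro t ht
    have hi : HasDerivAt (fun t : ℝ => 1 + (t : ℂ) * (w - 1)) (w - 1) t := by
      simpa using ((Complex.ofRealCLM.hasDerivAt (x := t)).mul_const (w - 1)).const_add 1
    rw [mul_comm]
    exact (hf _ (hseg t ht)).comp t hi
  have hc : ContinuousOn (fun t : ℝ => (w - 1) * Complex.digamma (1 + t * (w - 1)))
      (Set.uIcc (0 : ℝ) 1) :=
    continuousOn_const.mul (hdig.comp (by fun_prop) hseg)
  unfold logGamma
  rw [intervalIntegral.integral_eq_sub_of_hasDerivAt hder hc.intervalIntegrable]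
  simp [h1]

theorem exp_logGamma {w : ℂ} (hw : w ∈ Complex.slitPlane) :
    Complex.exp (logGamma w) = Complex.Gamma w := by
  obtain ⟨f, hf, he, h1⟩ := exists_log_Gamma
  rw [logGamma_eq_of_primitive hf h1 hw, he w hw]

theorem differentiableOn_logGamma : DifferentiableOn ℂ logGamma Complex.slitPlane := by
  obtain ⟨f, hf, he, h1⟩ := exists_log_Gamma
  exact DifferentiableOn.congr
    (fun w hw => (hf w hw).differentiableAt.differentiableWithinAt)
    (fun w hw => logGamma_eq_of_primitive hf h1 hw)

theorem logGamma_ofReal {x : ℝ} (hx : 0 < x) :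
    logGamma (x : ℂ) = (Real.log (Real.Gamma x) : ℝ) := by
  have hdc : ∀ y : ℝ, (starRingEnd ℂ) (Complex.digamma y) = Complex.digamma y := by
    intro y
    have h2 : (fun s => (starRingEnd ℂ) (Complex.Gamma ((starRingEnd ℂ) s))) = Complex.Gamma := by
      funext s
      rw [← Complex.Gamma_conj, Complex.conj_conj]
    have h3 : deriv (fun s => (starRingEnd ℂ) (Complex.Gamma ((starRingEnd ℂ) s))) (y : ℂ)
        = (starRingEnd ℂ) (deriv Complex.Gamma ((starRingEnd ℂ) (y : ℂ))) := by
      exact congrFun (deriv_conj_conj (f := Complex.Gamma)) (y : ℂ)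
    rw [h2, Complex.conj_ofReal] at h3
    rw [Complex.digamma_def, logDeriv_apply, map_div₀, ← h3, ← Complex.Gamma_conj,
      Complex.conj_ofReal]
  have hconj : (starRingEnd ℂ) (logGamma (x : ℂ)) = logGamma x := by
    unfold logGamma
    simp only [intervalIntegral.integral_of_le zero_le_one]
    rw [← integral_conj]
    congr 1
    funext t
    have e : (1 : ℂ) + t * (x - 1) = ((1 + t * (x - 1) : ℝ) : ℂ) := by push_cast; ring
    simp only [map_mul, map_sub, map_one, Complex.conj_ofReal]
    rw [e, hdc]
  obtain ⟨r, hr⟩ := Complex.conj_eq_iff_real.mp hconj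
  have := exp_logGamma (w := (x : ℂ)) (Complex.ofReal_mem_slitPlane.mpr hx)
  rw [hr, ← Complex.ofReal_exp, Complex.Gamma_ofReal, Complex.ofReal_inj] at this
  rw [hr, ← this, Real.log_exp]

end LeRoy

/-!
By the reflection formula the integrand is `-π g(s) / sin (π s)`, where `g` (`regularPart`) is
holomorphic off `[β/α, ∞)`. In the half-plane `re s < 0` its only singularities are the simple poles
`-1, -2, …`, and the residue at `-k` is `-1 / ([Γ(α k + β)]^γ z^k)`; the theorem says that the
integral along the loop is `2πi` times the sum of these residues.

A left loop may approach infinity in an irregular way and may touch the real line at `c` many times,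
so it is not deformed directly. Instead, for every `n` the integrand has a primitive `F n` on the
plane without `(-∞, -n - 1] ∪ [-n, ∞)`, which is star-shaped
(`exists_primitive_of_starConvex`). The loop lies in the domain of `F 0`, so the integral over a
bounded piece is the difference of the values of `F 0` at the ends (`LeftLoop.integral_pullback`),
and the improper integral is the difference of the limits of `F 0` at the two ends of the loop.

The limits exist because in a strip `|g(s)| ≤ C exp (re s)` for `re s ≤ 0`
(`exists_norm_regularPart_le`), a consequence of the superexponential growth of `Γ`; they depend
only on the limits `φ₁`, `φ₂` of the imaginary part (`exists_tendsto_of_norm_le_exp`). So they can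
be computed along the points `-N - 1/2 + i φ₁` and `-N - 1/2 + i φ₂`. Replacing `F 0` by `F N` in
the difference of the values at these points changes it by `2πi` times the sum of the first `N`
residues (`primitive_jump`), and the difference of the values of `F N` is an integral along a
vertical segment half way between two poles, which tends to `0` as `N → ∞`.
-/

namespace LeRoy

/-! ### Primitives on slit planes -/

/-- On a star-shaped open set a holomorphic function has a primitive, namely its integral along the
segments from the centre. -/
theorem exists_primitive_of_starConvex {U : Set ℂ} {c : ℂ} {f : ℂ → ℂ} (hU : IsOpen U)
    (hc : StarConvex ℝ c U) (hf : DifferentiableOn ℂ f U) :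
    ∃ F : ℂ → ℂ, ∀ s ∈ U, HasDerivAt F (f s) s := by
  have hseg : ∀ t ∈ Set.Icc (0 : ℝ) 1, ∀ s ∈ U, c + (t : ℂ) * (s - c) ∈ U := by
    intro t ht s hs
    have := hc.add_smul_mem (y := s - c) (by simpa using hs) ht.1 ht.2
    simpa using this
  have hf' : ContinuousOn (deriv f) U := (hf.deriv hU).continuousOn
  have hd : ∀ w ∈ U, HasDerivAt f (deriv f w) w := fun w hw =>
    (hf.differentiableAt (hU.mem_nhds hw)).hasDerivAt
  refine ⟨fun s => ∫ t in (0 : ℝ)..1, (s - c) * f (c + (t : ℂ) * (s - c)), fun s hs => ?_⟩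
  set F' : ℂ → ℝ → ℂ := fun x t =>
    f (c + (t : ℂ) * (x - c)) + (x - c) * (deriv f (c + (t : ℂ) * (x - c)) * t) with hF'
  obtain ⟨r, hr, hball⟩ := Metric.nhds_basis_closedBall.mem_iff.mp (hU.mem_nhds hs)
  have hmaps : Set.MapsTo (fun p : ℝ × ℂ => c + (p.1 : ℂ) * (p.2 - c))
      (Set.Icc (0 : ℝ) 1 ×ˢ Metric.closedBall s r) U := fun p hp => hseg _ hp.1 _ (hball hp.2)
  have hcont : ContinuousOn (fun p : ℝ × ℂ => F' p.2 p.1)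
      (Set.Icc (0 : ℝ) 1 ×ˢ Metric.closedBall s r) := by
    have h1 := hf.continuousOn.comp (by fun_prop) hmaps
    have h2 := hf'.comp (by fun_prop) hmaps
    exact h1.add ((by fun_prop : ContinuousOn (fun p : ℝ × ℂ => p.2 - c) _).mul
      (h2.mul (by fun_prop)))
  obtain ⟨C, hC⟩ := (isCompact_Icc.prod (isCompact_closedBall s r)).exists_bound_of_continuousOn
    hcont
  have hslice : ∀ x ∈ U, ContinuousOn (fun t : ℝ => f (c + (t : ℂ) * (x - c))) (Set.Icc 0 1) :=
    fun x hx => hf.continuousOn.comp (by fun_prop) fun t ht => hseg t ht x hx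
  have hslice' : ∀ x ∈ U, ContinuousOn (F' x) (Set.Icc 0 1) := fun x hx =>
    (hslice x hx).add (continuousOn_const.mul
      ((hf'.comp (by fun_prop) fun t ht => hseg t ht x hx).mul (by fun_prop)))
  have hIoc : Set.uIoc (0 : ℝ) 1 ⊆ Set.Icc 0 1 := by
    rw [Set.uIoc_of_le zero_le_one]; exact Set.Ioc_subset_Icc_self
  have hII : ∀ g : ℝ → ℂ, ContinuousOn g (Set.Icc 0 1) →
      IntervalIntegrable g MeasureTheory.volume 0 1 := fun g hg =>
    ContinuousOn.intervalIntegrable (by rwa [Set.uIcc_of_le zero_le_one])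
  have key := (intervalIntegral.hasDerivAt_integral_of_dominated_loc_of_deriv_le
    (μ := MeasureTheory.volume) (a := 0) (b := 1) (x₀ := s)
    (F := fun x t => (x - c) * f (c + (t : ℂ) * (x - c))) (F' := F') (bound := fun _ => C)
    (Metric.closedBall_mem_nhds s hr) ?_ (hII _ (continuousOn_const.mul (hslice s hs)))
    (((hslice' s hs).mono hIoc).aestronglyMeasurable measurableSet_uIoc)
    (Eventually.of_forall fun t ht x hx => hC (t, x) ⟨hIoc ht, hx⟩)
    intervalIntegrable_const
    (Eventually.of_forall fun t ht x hx => ?_)).2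
  · -- The differentiated integrand is the `t`-derivative of `t * f (c + t * (s - c))`.
    have hfund : ∫ t in (0 : ℝ)..1, F' s t = f s := by
      rw [intervalIntegral.integral_eq_sub_of_hasDerivAt
        (f := fun t : ℝ => (t : ℂ) * f (c + (t : ℂ) * (s - c)))]
      · simp
      · intro t ht
        rw [Set.uIcc_of_le zero_le_one] at ht
        have hid : HasDerivAt (fun t : ℝ => (t : ℂ)) 1 t := Complex.ofRealCLM.hasDerivAt
        have hi : HasDerivAt (fun t : ℝ => c + (t : ℂ) * (s - c)) (s - c) t := by
          simpa using (hid.mul_const (s - c)).const_add c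
        have h2 : HasDerivAt (fun t : ℝ => f (c + (t : ℂ) * (s - c))) _ t :=
          (hd _ (hseg t ht s hs)).comp t hi
        convert! hid.mul h2 using 1
        simp only [hF']
        ring
      · exact hII _ (hslice' s hs)
    rwa [hfund] at key
  · filter_upwards [hU.mem_nhds hs] with x hx
    exact ((continuousOn_const.mul (hslice x hx)).mono hIoc).aestronglyMeasurable
      measurableSet_uIoc
  · have hi : HasDerivAt (fun x : ℂ => c + (t : ℂ) * (x - c)) (t : ℂ) x := by
      simpa using (((hasDerivAt_id x).sub_const c).const_mul (t : ℂ)).const_add c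
    have h2 : HasDerivAt (fun x : ℂ => f (c + (t : ℂ) * (x - c))) _ x :=
      (hd _ (hseg t (hIoc ht) x (hball hx))).comp x hi
    convert! ((hasDerivAt_id x).sub_const c).mul h2 using 1
    simp only [hF', id]
    ring

/-- The complex plane without the two closed half-lines `(-∞, a]` and `[b, ∞)` of the real axis: the
two open half-planes, joined through the gap `(a, b)`. -/
def slitDomain (a b : ℝ) : Set ℂ := {s | s.im ≠ 0 ∨ (a < s.re ∧ s.re < b)}

theorem isOpen_slitDomain (a b : ℝ) : IsOpen (slitDomain a b) :=
  (isOpen_ne_fun Complex.continuous_im continuous_const).union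
    ((isOpen_lt continuous_const Complex.continuous_re).inter
      (isOpen_lt Complex.continuous_re continuous_const))

theorem starConvex_slitDomain {a b c : ℝ} (ha : a < c) (hb : c < b) :
    StarConvex ℝ (c : ℂ) (slitDomain a b) := by
  intro s hs p q hp hq hpq
  rcases hq.eq_or_lt with rfl | hq
  · right
    obtain rfl : p = 1 := by linarith
    simp [ha, hb]
  rcases hs with hs | hs
  · left
    simp [hq.ne', hs]
  · right
    have e : (p • (c : ℂ) + q • s).re = p * c + q * s.re := by simp
    obtain rfl : p = 1 - q := by linarith
    rw [e]
    constructor <;> nlinarith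

theorem slitDomain_mono {a b a' b' : ℝ} (ha : a' ≤ a) (hb : b ≤ b') :
    slitDomain a b ⊆ slitDomain a' b' := fun _ hs =>
  hs.imp_right fun h => ⟨ha.trans_lt h.1, h.2.trans_le hb⟩

theorem exists_primitive_slitDomain {a b : ℝ} (hab : a < b) {f : ℂ → ℂ}
    (hf : DifferentiableOn ℂ f (slitDomain a b)) :
    ∃ F : ℂ → ℂ, ∀ s ∈ slitDomain a b, HasDerivAt F (f s) s := by
  obtain ⟨c, h1, h2⟩ := exists_between hab
  exact exists_primitive_of_starConvex (isOpen_slitDomain a b) (starConvex_slitDomain h1 h2) hf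

theorem sub_eq_sub_of_hasDerivAt_slitDomain {a b : ℝ} (hab : a < b) {f F G : ℂ → ℂ}
    (hF : ∀ s ∈ slitDomain a b, HasDerivAt F (f s) s)
    (hG : ∀ s ∈ slitDomain a b, HasDerivAt G (f s) s)
    {p q : ℂ} (hp : p ∈ slitDomain a b) (hq : q ∈ slitDomain a b) :
    F p - F q = G p - G q := by
  obtain ⟨c, h1, h2⟩ := exists_between hab
  have hcm : (c : ℂ) ∈ slitDomain a b := Or.inr (by simp [h1, h2])
  have hconn := ((starConvex_slitDomain h1 h2).isPathConnected hcm).isConnected.isPreconnected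
  obtain ⟨k, hk⟩ := (isOpen_slitDomain a b).exists_is_const_of_deriv_eq_zero hconn
    (f := fun s => F s - G s)
    (fun s hs => ((hF s hs).sub (hG s hs)).differentiableAt.differentiableWithinAt)
    (fun s hs => by
      rw [show (fun s => F s - G s) = F - G from rfl, ((hF s hs).sub (hG s hs)).deriv]
      simp)
  have e1 := hk p hp
  have e2 := hk q hq
  linear_combination e1 - e2

/-! ### Integrals along a loop -/

namespace LeftLoop

variable {φ₁ φ₂ c : ℝ} (L : LeftLoop φ₁ φ₂ c)

theorem countable_corners : L.corners.Countable := by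
  have : L.corners = ⋃ n : ℕ, L.corners ∩ Set.Icc (-(n : ℝ)) n := by
    ext t
    simp only [Set.mem_iUnion, Set.mem_inter_iff, Set.mem_Icc]
    refine ⟨fun h => ?_, fun ⟨_, h⟩ => h.1⟩
    obtain ⟨n, hn⟩ := exists_nat_ge |t|
    exact ⟨n, h, abs_le.mp hn⟩
  rw [this]
  exact Set.countable_iUnion fun n => (L.finite_corners _ _).countable

theorem eventually_notMem_corners (t : ℝ) : ∀ᶠ u in 𝓝[≠] t, u ∉ L.corners := by
  have hfin : ((L.corners ∩ Set.Icc (t - 1) (t + 1)) \ {t}).Finite :=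
    (L.finite_corners _ _).subset Set.sdiff_subset
  have h1 : ∀ᶠ u in 𝓝 t, u ∉ (L.corners ∩ Set.Icc (t - 1) (t + 1)) \ {t} :=
    hfin.isClosed.isOpen_compl.mem_nhds (by simp)
  have h2 : ∀ᶠ u in 𝓝 t, u ∈ Set.Icc (t - 1) (t + 1) :=
    Icc_mem_nhds (by linarith) (by linarith)
  filter_upwards [nhdsWithin_le_nhds h1, nhdsWithin_le_nhds h2, self_mem_nhdsWithin]
    with u hu1 hu2 hu3 hc
  exact hu1 ⟨⟨hc, hu2⟩, hu3⟩

/-- Every parameter value, corner or not, is the end point of two short open intervals without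
corners. -/
theorem exists_radius (t : ℝ) : ∃ ε > 0, L.corners ∩ Set.Ioo (t - ε) t = ∅ ∧
    L.corners ∩ Set.Ioo t (t + ε) = ∅ := by
  have h := L.eventually_notMem_corners t
  rw [eventually_nhdsWithin_iff, Metric.eventually_nhds_iff] at h
  obtain ⟨ε, hε, h⟩ := h
  refine ⟨ε, hε, ?_, ?_⟩ <;>
  · refine Set.eq_empty_of_forall_notMem fun u ⟨hu, hu1, hu2⟩ => ?_
    refine h (y := u) ?_ ?_ hu
    · rw [Real.dist_eq, abs_lt]; constructor <;> linarith
    · simp only [Set.mem_compl_iff, Set.mem_singleton_iff]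
      intro h; linarith

theorem integrableOn_deriv {a b : ℝ} (h : L.corners ∩ Set.Ioo a b = ∅) :
    MeasureTheory.IntegrableOn (deriv L.toFun) (Set.Ioo a b) := by
  rcases lt_or_ge a b with hab | hab
  swap
  · simp [Set.Ioo_eq_empty_of_le hab]
  have h1 : MeasureTheory.IntegrableOn (derivWithin L.toFun (Set.Icc a b)) (Set.Icc a b) :=
    ((L.contDiffOn_toFun a b h).continuousOn_derivWithin (uniqueDiffOn_Icc hab)
      le_rfl).integrableOn_Icc
  refine (h1.mono_set Set.Ioo_subset_Icc_self).congr_fun (fun t ht => ?_) measurableSet_Ioo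
  exact derivWithin_of_mem_nhds (Icc_mem_nhds ht.1 ht.2)

theorem locallyIntegrable_deriv :
    MeasureTheory.LocallyIntegrable (deriv L.toFun) MeasureTheory.volume := by
  intro t
  obtain ⟨ε, hε, h1, h2⟩ := L.exists_radius t
  refine ⟨Set.Ioo (t - ε) (t + ε), Ioo_mem_nhds (by linarith) (by linarith), ?_⟩
  rw [← Set.Ioo_union_Ico_eq_Ioo (b := t) (by linarith) (by linarith)]
  exact (L.integrableOn_deriv h1).union
    ((integrableOn_Ico_iff_integrableOn_Ioo).mpr (L.integrableOn_deriv h2))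

theorem hasDerivAt {t : ℝ} (ht : t ∉ L.corners) :
    HasDerivAt L.toFun (deriv L.toFun t) t := by
  obtain ⟨ε, hε, h1, h2⟩ := L.exists_radius t
  have h : L.corners ∩ Set.Ioo (t - ε) (t + ε) = ∅ := by
    refine Set.eq_empty_of_forall_notMem fun u ⟨hu, hu1, hu2⟩ => ?_
    rcases lt_trichotomy u t with h | rfl | h
    · exact (h1.le ⟨hu, hu1, h⟩ : u ∈ (∅ : Set ℝ))
    · exact ht hu
    · exact (h2.le ⟨hu, h, hu2⟩ : u ∈ (∅ : Set ℝ))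
  exact (((L.contDiffOn_toFun _ _ h).differentiableOn one_ne_zero).differentiableAt
    (Icc_mem_nhds (by linarith) (by linarith))).hasDerivAt

theorem mem_slitDomain {a b : ℝ} (ha : a < c) (hb : c < b) (t : ℝ) :
    L.toFun t ∈ slitDomain a b := by
  by_cases h : (L.toFun t).im = 0
  · right
    rw [L.crossing t h]
    simp [ha, hb]
  · exact Or.inl h

variable {L} in
theorem intervalIntegrable_pullback {a b : ℝ} (ha : a < c) (hb : c < b) {f : ℂ → ℂ}
    (hf : ContinuousOn f (slitDomain a b)) (u v : ℝ) :
    IntervalIntegrable (L.pullback f) MeasureTheory.volume u v := by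
  have h1 : Continuous fun t => f (L.toFun t) :=
    hf.comp_continuous L.continuous_toFun (L.mem_slitDomain ha hb)
  exact (L.locallyIntegrable_deriv.integrableOn_isCompact isCompact_uIcc).intervalIntegrable
    |>.continuousOn_mul h1.continuousOn

/-- The fundamental theorem of calculus along a bounded piece of a loop. The corners are countably
many, and do not matter. -/
theorem integral_pullback {a b : ℝ} (ha : a < c) (hb : c < b) {f F : ℂ → ℂ}
    (hf : ContinuousOn f (slitDomain a b)) (hF : ∀ s ∈ slitDomain a b, HasDerivAt F (f s) s)
    (u v : ℝ) : ∫ t in u..v, L.pullback f t = F (L.toFun v) - F (L.toFun u) := by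
  refine MeasureTheory.integral_eq_of_hasDerivAt_off_countable (fun t => F (L.toFun t)) _
    L.countable_corners ?_ (fun t ht => ?_) (intervalIntegrable_pullback ha hb hf u v)
  · exact fun t _ => ((hF _ (L.mem_slitDomain ha hb t)).continuousAt.comp
      L.continuous_toFun.continuousAt).continuousWithinAt
  · exact (hF _ (L.mem_slitDomain ha hb t)).comp t (L.hasDerivAt ht.2)

end LeftLoop

/-! ### Growth of the gamma function in strips -/

/-- In a horizontal strip of the right half-plane, `Γ` grows faster than every exponential: once
`re w ≥ exp A`, the factor `w` in `Γ (w + 1) = w Γ w` is at least `exp A`, and on the remaining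
compact rectangle `Γ` is bounded away from zero. -/
theorem exists_mul_exp_le_norm_Gamma {b : ℝ} (hb : 0 < b) (A M : ℝ) :
    ∃ C > 0, ∀ w : ℂ, b ≤ w.re → |w.im| ≤ M → C * Real.exp (A * w.re) ≤ ‖Complex.Gamma w‖ := by
  set T : ℝ := max b (Real.exp A) with hT
  have hne : ∀ w : ℂ, 0 < w.re → Complex.Gamma w ≠ 0 := fun w => Complex.Gamma_ne_zero_of_re_pos
  set K : Set ℂ := Set.Icc b (T + 1) ×ℂ Set.Icc (-M) M with hK
  have hKc : IsCompact K := isCompact_Icc.reProdIm isCompact_Icc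
  have hcont : ContinuousOn (fun w : ℂ => Real.exp (-(A * w.re)) * ‖Complex.Gamma w‖) K := by
    refine ContinuousOn.mul (by fun_prop) (ContinuousOn.norm fun w hw => ?_)
    have hw' : 0 < w.re := hb.trans_le hw.1.1
    refine (Complex.differentiableAt_Gamma w fun m h => ?_).continuousAt.continuousWithinAt
    rw [h] at hw'
    simp only [Complex.neg_re, Complex.natCast_re] at hw'
    linarith [(Nat.cast_nonneg m : (0 : ℝ) ≤ m)]
  obtain ⟨C, hC, hbase⟩ : ∃ C > 0, ∀ w ∈ K, C * Real.exp (A * w.re) ≤ ‖Complex.Gamma w‖ := by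
    obtain ⟨C, hC, h⟩ := hKc.exists_forall_le' hcont (a := 0) fun w hw =>
      mul_pos (Real.exp_pos _) (norm_pos_iff.mpr (hne w (hb.trans_le hw.1.1)))
    refine ⟨C, hC, fun w hw => ?_⟩
    have := mul_le_mul_of_nonneg_right (h w hw) (Real.exp_pos (A * w.re)).le
    rwa [mul_right_comm, ← Real.exp_add, neg_add_cancel, Real.exp_zero, one_mul] at this
  refine ⟨C, hC, fun w hw hi => ?_⟩
  -- The unit steps go up from the compact rectangle `K`.
  have key : ∀ n : ℕ, ∀ w : ℂ, b ≤ w.re → |w.im| ≤ M → w.re ≤ T + 1 + n →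
      C * Real.exp (A * w.re) ≤ ‖Complex.Gamma w‖ := by
    intro n
    induction n with
    | zero =>
      intro w hw hi hn
      exact hbase w ⟨⟨hw, by simpa using hn⟩, abs_le.mp hi⟩
    | succ n ih =>
      intro w hw hi hn
      rcases le_or_gt w.re (T + 1) with h | h
      · exact hbase w ⟨⟨hw, h⟩, abs_le.mp hi⟩
      have hTb : b ≤ T := le_max_left _ _
      have hTA : Real.exp A ≤ T := le_max_right _ _
      have hre : (w - 1).re = w.re - 1 := by simp
      have h1 := ih (w - 1) (by rw [hre]; linarith) (by simpa using hi)
        (by rw [hre]; push_cast at hn; linarith)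
      have h0 : w - 1 ≠ 0 := fun h0 => by
        rw [h0, Complex.zero_re] at hre
        linarith
      have h2 : Real.exp A ≤ ‖w - 1‖ :=
        calc Real.exp A ≤ (w - 1).re := by rw [hre]; linarith
          _ ≤ ‖w - 1‖ := Complex.re_le_norm _
      have h3 := Complex.Gamma_add_one (w - 1) h0
      rw [sub_add_cancel] at h3
      rw [h3, norm_mul]
      calc C * Real.exp (A * w.re) = Real.exp A * (C * Real.exp (A * (w - 1).re)) := by
            rw [hre, mul_left_comm, ← Real.exp_add]; ring_nf
        _ ≤ _ := mul_le_mul h2 h1 (by positivity) (norm_nonneg _)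
  obtain ⟨n, hn⟩ := exists_nat_ge w.re
  exact key n w hw hi (by linarith [le_max_left b (Real.exp A)])

/-- The modulus of the branch does not depend on `arg Γ`, since `γ` is real. -/
theorem norm_gammaPow {γ : ℝ} {w : ℂ} (hw : w ∈ Complex.slitPlane) :
    ‖gammaPow γ w‖ = ‖Complex.Gamma w‖ ^ γ := by
  rw [gammaPow, Complex.norm_exp, ← exp_logGamma hw, Complex.norm_exp, ← Real.exp_mul,
    Complex.re_ofReal_mul, mul_comm]

theorem gammaPow_ofReal {γ x : ℝ} (hx : 0 < x) : gammaPow γ x = (Real.Gamma x ^ γ : ℝ) := by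
  rw [gammaPow, logGamma_ofReal hx, Real.rpow_def_of_pos (Real.Gamma_pos_of_pos hx), mul_comm]
  push_cast
  rfl

/-! ### The integrand without its poles -/

/-- The part of the integrand without poles: `(-z)^s / [Γ(-α s + β)]^γ`. -/
noncomputable def regularPart (α β γ θ : ℝ) (z s : ℂ) : ℂ :=
  Complex.exp (s * (Real.log ‖z‖ + Complex.I * θ)) / gammaPow γ (-(α * s) + β)

/-- The reflection formula. At the poles both sides are `0`, by the conventions for `Γ` and for
division. -/
theorem integrand_eq (α β γ θ : ℝ) (z s : ℂ) :
    integrand α β γ θ z s =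
      -(Real.pi * regularPart α β γ θ z s / Complex.sin (Real.pi * s)) := by
  have h := Complex.Gamma_mul_Gamma_one_sub (-s)
  rw [sub_neg_eq_add, mul_neg, Complex.sin_neg] at h
  rw [integrand, regularPart, h]
  ring

variable {α β γ θ : ℝ} {z : ℂ}

/-- The argument of the branch of `Γ ^ γ` stays off the cut, both in the half-plane `re s ≤ 0` and
away from the real axis. -/
theorem arg_mem_slitPlane (hα : 0 < α) (hβ : 0 < β) {s : ℂ}
    (hs : s.im ≠ 0 ∨ s.re ≤ 0) : -(α * s) + β ∈ Complex.slitPlane := by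
  rw [Complex.mem_slitPlane_iff]
  rcases hs with hs | hs
  · right
    simpa using ⟨hα.ne', hs⟩
  · left
    have : (-(α * s) + β : ℂ).re = α * -s.re + β := by simp
    rw [this]
    nlinarith

theorem differentiableAt_regularPart (hα : 0 < α) (hβ : 0 < β) {s : ℂ}
    (hs : s.im ≠ 0 ∨ s.re ≤ 0) :
    DifferentiableAt ℂ (regularPart α β γ θ z) s := by
  have h1 : DifferentiableAt ℂ logGamma (-(α * s) + β) :=
    differentiableOn_logGamma.differentiableAt
      (Complex.isOpen_slitPlane.mem_nhds (arg_mem_slitPlane hα hβ hs))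
  have h2 : DifferentiableAt ℂ (fun s => logGamma (-(α * s) + β)) s :=
    h1.comp s (f := fun s : ℂ => -(α * s) + (β : ℂ)) (by fun_prop)
  unfold regularPart gammaPow
  exact (by fun_prop : DifferentiableAt ℂ _ s).div (h2.const_mul _).cexp (Complex.exp_ne_zero _)

/-- In horizontal strips the superexponential growth of `Γ` defeats `(-z) ^ s` as `re s → -∞`. This
estimate gives the convergence of the integral, that of the series, and the vanishing of the
remainder that relates them. -/
theorem exists_norm_regularPart_le (hα : 0 < α) (hβ : 0 < β) (hγ : 0 < γ) (θ : ℝ) (z : ℂ)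
    (M : ℝ) : ∃ C > 0, ∀ s : ℂ, s.re ≤ 0 → |s.im| ≤ M →
      ‖regularPart α β γ θ z s‖ ≤ C * Real.exp s.re := by
  -- With this exponent the growth of `Γ ^ γ` beats `|z| ^ s.re` by exactly `exp s.re`.
  set A : ℝ := (1 - Real.log ‖z‖) / (γ * α) with hA
  obtain ⟨C, hC, h⟩ := exists_mul_exp_le_norm_Gamma hβ A (α * M)
  refine ⟨Real.exp (|θ| * M) / (C ^ γ * Real.exp (γ * (A * β))), by positivity,
    fun s hre him => ?_⟩
  have e1 : (-(α * s) + β : ℂ).re = -(α * s.re) + β := by simp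
  have e2 : (-(α * s) + β : ℂ).im = -(α * s.im) := by simp
  have e3 : (s * (Real.log ‖z‖ + Complex.I * θ)).re = s.re * Real.log ‖z‖ - s.im * θ := by simp
  have h1 := h (-(α * s) + β) (by rw [e1]; nlinarith)
    (by rw [e2, abs_neg, abs_mul, abs_of_pos hα]; gcongr)
  have h2 := Real.rpow_le_rpow (by positivity) h1 hγ.le
  rw [Real.mul_rpow hC.le (Real.exp_pos _).le, ← Real.exp_mul, e1] at h2
  have h3 : -(s.im * θ) ≤ |θ| * M :=
    calc -(s.im * θ) ≤ |s.im * θ| := neg_le_abs _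
      _ = |θ| * |s.im| := by rw [abs_mul, mul_comm]
      _ ≤ _ := by gcongr
  have h4 : A * (-(α * s.re) + β) * γ = γ * (A * β) + (s.re * Real.log ‖z‖ - s.re) := by
    rw [hA]; field_simp; ring
  rw [h4] at h2
  rw [regularPart, norm_div, Complex.norm_exp, e3,
    norm_gammaPow (arg_mem_slitPlane hα hβ (Or.inr hre)), div_le_iff₀ (by
      refine lt_of_lt_of_le ?_ h2; positivity)]
  calc Real.exp (s.re * Real.log ‖z‖ - s.im * θ)
      ≤ Real.exp (s.re * Real.log ‖z‖ + |θ| * M) := Real.exp_le_exp.mpr (by linarith)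
    _ = Real.exp (|θ| * M) / (C ^ γ * Real.exp (γ * (A * β))) * Real.exp s.re *
        (C ^ γ * Real.exp (γ * (A * β) + (s.re * Real.log ‖z‖ - s.re))) := by
      rw [Real.exp_add, Real.exp_add (γ * (A * β)), Real.exp_sub]
      field_simp
    _ ≤ _ := by gcongr

/-! ### Lower bounds for the sine -/

theorem sin_pi_mul_ne_zero {s : ℂ} (hs : ∀ n : ℤ, s ≠ n) : Complex.sin (Real.pi * s) ≠ 0 := by
  intro h
  obtain ⟨n, hn⟩ := Complex.sin_eq_zero_iff.mp h
  refine hs n (mul_left_cancel₀ (Complex.ofReal_ne_zero.mpr Real.pi_ne_zero) ?_)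
  rw [hn, mul_comm]

theorem norm_sin_sq (s : ℂ) :
    ‖Complex.sin s‖ ^ 2 = Real.sin s.re ^ 2 + Real.sinh s.im ^ 2 := by
  have h : Complex.sin s = ((Real.sin s.re * Real.cosh s.im : ℝ) : ℂ) +
      ((Real.cos s.re * Real.sinh s.im : ℝ) : ℂ) * Complex.I := by
    rw [Complex.sin_eq]; push_cast; ring
  rw [h, Complex.sq_norm, Complex.normSq_add_mul_I]
  have h1 := Real.cosh_sq s.im
  have h2 := Real.sin_sq_add_cos_sq s.re
  linear_combination Real.sin s.re ^ 2 * h1 + Real.sinh s.im ^ 2 * h2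

theorem abs_im_le_norm_sin (s : ℂ) : |s.im| ≤ ‖Complex.sin s‖ := by
  have h : |s.im| ≤ |Real.sinh s.im| := by
    rw [Real.abs_sinh]
    exact Real.self_le_sinh_iff.mpr (abs_nonneg _)
  refine h.trans (abs_le_of_sq_le_sq ?_ (norm_nonneg _))
  rw [norm_sin_sq]
  exact le_add_of_nonneg_left (sq_nonneg _)

/-- Half way between two consecutive poles, `|sin (π s)| = cosh (π im s)`. -/
theorem one_le_norm_sin_of_re (n : ℕ) {s : ℂ} (hs : s.re = -(n : ℝ) - 1 / 2) :
    1 ≤ ‖Complex.sin (Real.pi * s)‖ := by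
  have h := norm_sin_sq (Real.pi * s)
  have e : (Real.pi * s : ℂ).re = -((n * Real.pi) + Real.pi / 2) := by
    simp [hs]; ring
  have h1 : Real.sin (-((n * Real.pi) + Real.pi / 2)) ^ 2 = 1 := by
    rw [Real.sin_neg, Real.sin_add_pi_div_two, Real.cos_nat_mul_pi, neg_sq, ← pow_mul, mul_comm,
      pow_mul]
    simp
  rw [e, h1] at h
  nlinarith [norm_nonneg (Complex.sin (Real.pi * s)), sq_nonneg (Real.sinh (Real.pi * s : ℂ).im)]

/-! ### Limits of primitives at infinity -/

theorem convex_reProdIm {A B : Set ℝ} (hA : Convex ℝ A) (hB : Convex ℝ B) :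
    Convex ℝ (A ×ℂ B) :=
  (hA.is_linear_preimage Complex.reLm.isLinear).inter
    (hB.is_linear_preimage Complex.imLm.isLinear)

/-- If `f` is dominated by `exp (re s)` in the left part of a horizontal strip, then a primitive of
`f` has a limit as `re s → -∞` in the strip, uniformly in `im s`. -/
theorem exists_tendsto_of_norm_le_exp {f F : ℂ → ℂ} {u v C : ℝ} (hC : 0 ≤ C)
    (hF : ∀ s : ℂ, s.re ≤ 0 → s.im ∈ Set.Icc u v → HasDerivAt F (f s) s)
    (hf : ∀ s : ℂ, s.re ≤ 0 → s.im ∈ Set.Icc u v → ‖f s‖ ≤ C * Real.exp s.re) :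
    ∃ l : ℂ, Tendsto F (comap Complex.re atBot ⊓ 𝓟 {s | s.im ∈ Set.Icc u v}) (𝓝 l) := by
  set 𝓛 : Filter ℂ := comap Complex.re atBot ⊓ 𝓟 {s | s.im ∈ Set.Icc u v}
  rcases 𝓛.eq_or_neBot with h | h
  · exact ⟨0, by rw [h]; exact tendsto_bot⟩
  refine cauchy_map_iff_exists_tendsto.mp ?_
  -- Along a horizontal segment the increment is at most the increment of `C * exp`.
  have hhor : ∀ r : ℝ, ∀ p : ℂ, r ≤ p.re → p.re ≤ 0 → p.im ∈ Set.Icc u v →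
      ‖F p - F (r + p.im * Complex.I)‖ ≤ C * Real.exp p.re := by
    intro r p hr hp0 hp
    have hpath : ∀ t : ℝ, t ≤ p.re → HasDerivAt (fun t : ℝ => F (t + p.im * Complex.I))
        (f (t + p.im * Complex.I)) t := by
      intro t ht
      have hi : HasDerivAt (fun t : ℝ => (t : ℂ) + p.im * Complex.I) 1 t :=
        (Complex.ofRealCLM.hasDerivAt (x := t)).add_const _
      have h1 := (hF (t + p.im * Complex.I) (by simpa using ht.trans hp0)
        (by simpa using hp)).comp t hi
      rwa [mul_one] at h1
    have := image_norm_le_of_norm_deriv_right_le_deriv_boundary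
      (f := fun t : ℝ => F (t + p.im * Complex.I) - F (r + p.im * Complex.I))
      (f' := fun t => f (t + p.im * Complex.I)) (a := r) (b := p.re)
      (B := fun t => C * (Real.exp t - Real.exp r)) (B' := fun t => C * Real.exp t)
      (fun t ht => ((hpath t ht.2).continuousAt.sub continuousAt_const).continuousWithinAt)
      (fun t ht => ((hpath t ht.2.le).sub_const _).hasDerivWithinAt) (by simp)
      (fun t => ((Real.hasDerivAt_exp t).sub_const _).const_mul C)
      (fun t ht => by
        simpa using hf (t + p.im * Complex.I) (by simpa using ht.2.le.trans hp0)
          (by simpa using hp))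
      (Set.right_mem_Icc.mpr hr)
    simp only [Complex.re_add_im] at this
    refine this.trans ?_
    gcongr
    linarith [Real.exp_pos r]
  have hver : ∀ r : ℝ, r ≤ 0 → ∀ y ∈ Set.Icc u v, ∀ y' ∈ Set.Icc u v,
      ‖F (r + y * Complex.I) - F (r + y' * Complex.I)‖ ≤ C * Real.exp r * (v - u) := by
    intro r hr y hy y' hy'
    have hconv : Convex ℝ ({r} ×ℂ Set.Icc u v) := convex_reProdIm (convex_singleton r) (convex_Icc u v)
    have h1 := hconv.norm_image_sub_le_of_norm_hasDerivWithin_le (f := F) (f' := f)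
      (C := C * Real.exp r) (x := r + y' * Complex.I) (y := r + y * Complex.I)
      (fun s hs => (hF s (hs.1.le.trans hr) hs.2).hasDerivWithinAt)
      (fun s hs => by
        have h2 := hf s (hs.1.le.trans hr) hs.2
        rwa [show s.re = r from hs.1] at h2)
      (by simpa [Complex.mem_reProdIm] using hy') (by simpa [Complex.mem_reProdIm] using hy)
    refine h1.trans ?_
    gcongr
    rw [add_sub_add_left_eq_sub, ← sub_mul, ← Complex.ofReal_sub, norm_mul, Complex.norm_I,
      mul_one, Complex.norm_real, Real.norm_eq_abs, abs_le]
    constructor <;> linarith [hy.1, hy.2, hy'.1, hy'.2]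
  refine Metric.cauchy_iff.2 ⟨h.map F, fun ε hε => ?_⟩
  have hlim : Tendsto (fun X : ℝ => C * Real.exp X * (2 + (v - u))) atBot (𝓝 0) := by
    simpa using (Real.tendsto_exp_atBot.const_mul C).mul_const (2 + (v - u))
  obtain ⟨X, hX, hX0⟩ := ((hlim.eventually_lt_const hε).and (eventually_le_atBot 0)).exists
  refine ⟨F '' {s | s.re ≤ X ∧ s.im ∈ Set.Icc u v}, image_mem_map ?_, ?_⟩
  · exact inter_mem_inf (preimage_mem_comap (Iic_mem_atBot X)) (mem_principal_self _)
  · rintro _ ⟨p, ⟨hp, hp'⟩, rfl⟩ _ ⟨q, ⟨hq, hq'⟩, rfl⟩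
    set r := min p.re q.re
    have hr : r ≤ X := (min_le_left _ _).trans hp
    have h1 := hhor r p (min_le_left _ _) (hp.trans hX0) hp'
    have h2 := hhor r q (min_le_right _ _) (hq.trans hX0) hq'
    have h3 := hver r (hr.trans hX0) _ hp' _ hq'
    have huv : 0 ≤ v - u := by linarith [hp'.1, hp'.2]
    have g1 : C * Real.exp p.re ≤ C * Real.exp X := by gcongr
    have g2 : C * Real.exp q.re ≤ C * Real.exp X := by gcongr
    have g3 : C * Real.exp r * (v - u) ≤ C * Real.exp X * (v - u) := by gcongr
    rw [dist_eq_norm]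
    calc ‖F p - F q‖ = ‖(F p - F (r + p.im * Complex.I)) + (F (r + p.im * Complex.I) -
          F (r + q.im * Complex.I)) - (F q - F (r + q.im * Complex.I))‖ := by congr 1; ring
      _ ≤ ‖F p - F (r + p.im * Complex.I)‖ + ‖F (r + p.im * Complex.I) -
          F (r + q.im * Complex.I)‖ + ‖F q - F (r + q.im * Complex.I)‖ :=
        (norm_sub_le _ _).trans (by gcongr; exact norm_add_le _ _)
      _ ≤ C * Real.exp X * (2 + (v - u)) := by linarith
      _ < ε := hX

/-! ### Holomorphy and decay of the integrand -/

theorem ne_int_of_mem_slitDomain {n : ℕ} {s : ℂ} (hs : s ∈ slitDomain (-n - 1) (-n)) (k : ℤ) :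
    s ≠ k := by
  rintro rfl
  rcases hs with hs | ⟨h1, h2⟩
  · simp at hs
  · rw [Complex.intCast_re] at h1 h2
    have h1' : -(n : ℤ) - 1 < k := by exact_mod_cast h1
    have h2' : k < -(n : ℤ) := by exact_mod_cast h2
    omega

theorem differentiableOn_integrand (hα : 0 < α) (hβ : 0 < β) (n : ℕ) :
    DifferentiableOn ℂ (integrand α β γ θ z) (slitDomain (-n - 1) (-n)) := by
  intro s hs
  have h1 : DifferentiableAt ℂ (regularPart α β γ θ z) s :=
    differentiableAt_regularPart hα hβ <|
        hs.imp_right fun h => h.2.le.trans (by simp)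
  have h2 := sin_pi_mul_ne_zero (ne_int_of_mem_slitDomain hs)
  refine DifferentiableAt.differentiableWithinAt ?_
  rw [show integrand α β γ θ z = _ from funext (integrand_eq α β γ θ z)]
  exact ((h1.const_mul _).div (by fun_prop) h2).neg

theorem exists_norm_integrand_le_of_im (hα : 0 < α) (hβ : 0 < β) (hγ : 0 < γ) (θ : ℝ) (z : ℂ)
    {δ : ℝ} (hδ : 0 < δ) (M : ℝ) : ∃ C > 0, ∀ s : ℂ, s.re ≤ 0 → δ ≤ |s.im| → |s.im| ≤ M →
      ‖integrand α β γ θ z s‖ ≤ C * Real.exp s.re := by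
  obtain ⟨C, hC, h⟩ := exists_norm_regularPart_le hα hβ hγ θ z M
  refine ⟨C / δ, by positivity, fun s h1 h2 h3 => ?_⟩
  have h4 : Real.pi * δ ≤ ‖Complex.sin (Real.pi * s)‖ := by
    refine le_trans ?_ (abs_im_le_norm_sin _)
    rw [Complex.im_ofReal_mul, abs_mul,
      abs_of_pos Real.pi_pos]
    gcongr
  rw [integrand_eq, norm_neg, norm_div, norm_mul, Complex.norm_real, Real.norm_eq_abs,
    abs_of_pos Real.pi_pos]
  calc _ ≤ Real.pi * (C * Real.exp s.re) / (Real.pi * δ) := by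
        gcongr; exact h s h1 h3
    _ = C / δ * Real.exp s.re := by field_simp

theorem exists_norm_integrand_le_of_re (hα : 0 < α) (hβ : 0 < β) (hγ : 0 < γ) (θ : ℝ) (z : ℂ)
    (M : ℝ) : ∃ C > 0, ∀ n : ℕ, ∀ s : ℂ, s.re = -(n : ℝ) - 1 / 2 → |s.im| ≤ M →
      ‖integrand α β γ θ z s‖ ≤ C * Real.exp (-(n : ℝ)) := by
  obtain ⟨C, hC, h⟩ := exists_norm_regularPart_le hα hβ hγ θ z M
  refine ⟨Real.pi * C, by positivity, fun n s h1 h2 => ?_⟩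
  have hn : (0 : ℝ) ≤ n := n.cast_nonneg
  have h3 := one_le_norm_sin_of_re n h1
  rw [integrand_eq, norm_neg, norm_div, norm_mul, Complex.norm_real, Real.norm_eq_abs,
    abs_of_pos Real.pi_pos]
  calc _ ≤ Real.pi * (C * Real.exp s.re) / 1 := by
        gcongr; exact h s (by linarith) h2
    _ ≤ Real.pi * C * Real.exp (-(n : ℝ)) := by
        rw [div_one, mul_assoc]; gcongr; linarith

/-! ### Passing a pole -/

theorem log_sub_log_neg_of_im_pos {w : ℂ} (hw : 0 < w.im) :
    Complex.log w - Complex.log (-w) = Real.pi * Complex.I := by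
  rw [Complex.log, Complex.log, norm_neg, Complex.arg_neg_eq_arg_sub_pi_of_im_pos hw]
  push_cast; ring

theorem log_sub_log_neg_of_im_neg {w : ℂ} (hw : w.im < 0) :
    Complex.log w - Complex.log (-w) = -(Real.pi * Complex.I) := by
  rw [Complex.log, Complex.log, norm_neg, Complex.arg_neg_eq_arg_add_pi_of_im_neg hw]
  push_cast; ring

/-- On a domain whose gap contains the single pole `-(n + 1)`, the integrand is the sum of a
holomorphic function and of its principal part at this pole. -/
theorem exists_integrand_eq_add_pole (hα : 0 < α) (hβ : 0 < β) (n : ℕ) :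
    ∃ H : ℂ → ℂ, DifferentiableOn ℂ H (slitDomain (-n - 2) (-n)) ∧
      ∀ s ∈ slitDomain (-n - 2) (-n), s ≠ -(n + 1) → integrand α β γ θ z s = H s +
        -((-1) ^ (n + 1) * regularPart α β γ θ z (-(n + 1))) / (s + (n + 1)) := by
  set S := slitDomain (-(n : ℝ) - 2) (-n) with hS
  set m : ℂ := -((n : ℂ) + 1) with hm
  have hmS : m ∈ S := Or.inr (by
    rw [hm, show (-((n : ℂ) + 1)).re = -((n : ℝ) + 1) by simp]
    constructor <;> linarith)
  set σ : ℂ → ℂ := fun s => Complex.sin (Real.pi * s) with hσ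
  have hσd : Differentiable ℂ σ := by fun_prop
  have hcos : Complex.cos (Real.pi * m) = (-1) ^ (n + 1) := by
    rw [hm, mul_neg, Complex.cos_neg, mul_comm]
    have h := Real.cos_nat_mul_pi (n + 1)
    exact_mod_cast congrArg (fun x : ℝ => (x : ℂ)) h
  have hσm : σ m = 0 := by
    simp only [hσ, hm]
    rw [mul_neg, Complex.sin_neg, mul_comm, neg_eq_zero]
    exact_mod_cast Complex.sin_nat_mul_pi (n + 1)
  have hσ' : deriv σ m = Real.pi * (-1) ^ (n + 1) := by
    have hi : HasDerivAt (fun s : ℂ => (Real.pi : ℂ) * s) Real.pi m := by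
      simpa using (hasDerivAt_id m).const_mul (Real.pi : ℂ)
    rw [hi.csin.deriv, hcos, mul_comm]
  have hslope : ∀ s, s ≠ m → dslope σ m s = σ s / (s - m) := fun s hs => by
    rw [dslope_of_ne _ hs, slope_def_field, hσm, sub_zero]
  have hpi : (Real.pi : ℂ) ≠ 0 := Complex.ofReal_ne_zero.mpr Real.pi_ne_zero
  have hne : ∀ s ∈ S, dslope σ m s ≠ 0 := by
    intro s hs
    rcases eq_or_ne s m with rfl | hsm
    · rw [dslope_same, hσ']
      exact mul_ne_zero hpi (pow_ne_zero _ (by norm_num))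
    · rw [hslope s hsm]
      refine div_ne_zero (sin_pi_mul_ne_zero ?_) (sub_ne_zero.mpr hsm)
      rintro k rfl
      rcases hs with hs | ⟨h1, h2⟩
      · simp at hs
      · rw [Complex.intCast_re] at h1 h2
        have h1' : -(n : ℤ) - 2 < k := by exact_mod_cast h1
        have h2' : k < -(n : ℤ) := by exact_mod_cast h2
        obtain rfl : k = -(n + 1) := by omega
        exact hsm (by simp [hm])
  -- The integrand multiplied by `s - m`, with the value at `m` filled in.
  set q : ℂ → ℂ := fun s => -(Real.pi * regularPart α β γ θ z s) / dslope σ m s with hq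
  have hqd : DifferentiableOn ℂ q S := by
    intro s hs
    have h1 : DifferentiableAt ℂ (regularPart α β γ θ z) s :=
      differentiableAt_regularPart hα hβ <|
        hs.imp_right fun h => h.2.le.trans (by simp)
    have h2 : DifferentiableAt ℂ (dslope σ m) s :=
      ((Complex.differentiableOn_dslope univ_mem).mpr hσd.differentiableOn).differentiableAt
        univ_mem
    exact ((h1.const_mul _).neg.div h2 (hne s hs)).differentiableWithinAt
  refine ⟨dslope q m, (Complex.differentiableOn_dslope
    ((isOpen_slitDomain _ _).mem_nhds hmS)).mpr hqd, fun s hs hsm => ?_⟩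
  have hqm : q m = -((-1) ^ (n + 1) * regularPart α β γ θ z m) := by
    simp only [hq]
    rw [dslope_same, hσ']
    have h1 : ((-1 : ℂ) ^ (n + 1)) * (-1) ^ (n + 1) = 1 := by
      rw [← mul_pow]; simp
    have h2 : ((-1 : ℂ) ^ (n + 1)) ≠ 0 := pow_ne_zero _ (by norm_num)
    field_simp
    linear_combination (-regularPart α β γ θ z m) * (h1.symm)
  have hsub : s - m ≠ 0 := sub_ne_zero.mpr hsm
  have hσs : σ s ≠ 0 := fun h => hne s hs (by rw [hslope s hsm, h, zero_div])
  rw [show s + ((n : ℂ) + 1) = s - m by rw [hm]; ring, ← hqm, dslope_of_ne _ hsm,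
    slope_def_field, ← add_div, sub_add_cancel, integrand_eq]
  simp only [hq]
  rw [hslope s hsm]
  change -(_ / σ s) = _
  field_simp

/-- The residue theorem in the form needed here. Between a point `q` of the lower and a point `p` of
the upper half-plane, the increments of the primitives of the integrand through two adjacent gaps
differ by `2πi` times the residue at the pole `-(n + 1)` between the gaps. Indeed the holomorphic
part of the integrand contributes the same to both, and the principal part has the primitive
`log (s + n + 1)` through one gap and `log (-(s + n + 1))` through the other. -/
theorem primitive_jump (hα : 0 < α) (hβ : 0 < β) {n : ℕ} {F₀ F₁ : ℂ → ℂ}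
    (h₀ : ∀ s ∈ slitDomain (-n - 1) (-n), HasDerivAt F₀ (integrand α β γ θ z s) s)
    (h₁ : ∀ s ∈ slitDomain (-n - 2) (-n - 1), HasDerivAt F₁ (integrand α β γ θ z s) s)
    {p q : ℂ} (hp : 0 < p.im) (hq : q.im < 0) :
    F₀ p - F₀ q = F₁ p - F₁ q + 2 * Real.pi * Complex.I *
      -((-1) ^ (n + 1) * regularPart α β γ θ z (-(n + 1))) := by
  obtain ⟨H, hH, hHeq⟩ := exists_integrand_eq_add_pole (γ := γ) (θ := θ) (z := z) hα hβ n
  set r : ℂ := -((-1) ^ (n + 1) * regularPart α β γ θ z (-(n + 1)))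
  obtain ⟨G, hG⟩ := exists_primitive_slitDomain (by linarith) hH
  have hshift : ∀ s : ℂ, HasDerivAt (fun s : ℂ => s + ((n : ℂ) + 1)) 1 s := fun s =>
    (hasDerivAt_id s).add_const _
  have hre : ∀ s : ℂ, (s + ((n : ℂ) + 1)).re = s.re + (n + 1) := fun s => by simp
  have him : ∀ s : ℂ, (s + ((n : ℂ) + 1)).im = s.im := fun s => by simp
  have hne : ∀ s : ℂ, s + ((n : ℂ) + 1) ≠ 0 → s ≠ -((n : ℂ) + 1) := fun s h h' =>
    h (by rw [h']; ring)
  have e₀ := sub_eq_sub_of_hasDerivAt_slitDomain (by linarith) h₀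
    (G := fun s => G s + r * Complex.log (s + (n + 1))) (fun s hs => by
      have hsS := slitDomain_mono (a' := -n - 2) (by linarith) le_rfl hs
      have hsp : s + ((n : ℂ) + 1) ∈ Complex.slitPlane := by
        rw [Complex.mem_slitPlane_iff, hre, him]
        exact hs.symm.imp (fun h => by linarith [h.1]) id
      have h := (hG s hsS).add (((hshift s).clog hsp).const_mul r)
      rw [hHeq s hsS (hne s (Complex.slitPlane_ne_zero hsp))]
      convert! h using 1
      ring) (Or.inl hp.ne') (Or.inl hq.ne)
  have e₁ := sub_eq_sub_of_hasDerivAt_slitDomain (by linarith) h₁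
    (G := fun s => G s + r * Complex.log (-(s + (n + 1)))) (fun s hs => by
      have hsS := slitDomain_mono (b' := -n) le_rfl (by linarith) hs
      have hsp : -(s + ((n : ℂ) + 1)) ∈ Complex.slitPlane := by
        rw [Complex.mem_slitPlane_iff, Complex.neg_re, Complex.neg_im, hre, him, neg_ne_zero]
        exact hs.symm.imp (fun h => by linarith [h.2]) id
      have h0 := neg_ne_zero.mp (Complex.slitPlane_ne_zero hsp)
      have h := (hG s hsS).add (((hshift s).neg.clog hsp).const_mul r)
      rw [hHeq s hsS (hne s h0)]
      convert! h using 1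
      rw [Pi.neg_apply, neg_div_neg_eq]
      ring) (Or.inl hp.ne') (Or.inl hq.ne)
  have l₁ := log_sub_log_neg_of_im_pos (w := p + (n + 1)) (by rwa [him])
  have l₂ := log_sub_log_neg_of_im_neg (w := q + (n + 1)) (by rwa [him])
  linear_combination e₀ - e₁ + r * l₁ - r * l₂

/-! ### The series of residues -/

/-- The residue at `-(n + 1)` is the negative of the corresponding term of the series. The choice of
`θ` drops out, as the exponent is an integer. -/
theorem neg_one_pow_mul_regularPart (hα : 0 < α) (hβ : 0 < β)
    (hθ : (‖z‖ : ℂ) * Complex.exp (Complex.I * θ) = -z) (hz : z ≠ 0) (n : ℕ) :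
    (-1) ^ (n + 1) * regularPart α β γ θ z (-(n + 1)) =
      1 / ((Real.Gamma (α * ((n : ℝ) + 1) + β) ^ γ : ℝ) : ℂ) * (1 / z ^ (n + 1)) := by
  have h1 : -(α * -((n : ℂ) + 1)) + β = ((α * ((n : ℝ) + 1) + β : ℝ) : ℂ) := by
    push_cast; ring
  have h2 : Complex.exp (-((n : ℂ) + 1) * (Real.log ‖z‖ + Complex.I * θ)) =
      1 / (-z) ^ (n + 1) := by
    have h3 : Complex.exp (Real.log ‖z‖ + Complex.I * θ) = -z := by
      rw [Complex.exp_add, ← Complex.ofReal_exp, Real.exp_log (norm_pos_iff.mpr hz), hθ]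
    rw [← h3, ← Complex.exp_nat_mul, neg_mul, Complex.exp_neg, one_div]
    push_cast
    rfl
  rw [regularPart, h1, gammaPow_ofReal (by positivity), h2, neg_pow z]
  have h4 : ((-1 : ℂ) ^ (n + 1)) ≠ 0 := pow_ne_zero _ (by norm_num)
  field_simp

theorem summable_terms (hα : 0 < α) (hβ : 0 < β) (hγ : 0 < γ)
    (hθ : (‖z‖ : ℂ) * Complex.exp (Complex.I * θ) = -z) (hz : z ≠ 0) :
    Summable (fun k : ℕ =>
      1 / ((Real.Gamma (α * ((k : ℝ) + 1) + β) ^ γ : ℝ) : ℂ) * (1 / z ^ (k + 1))) := by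
  obtain ⟨C, hC, h⟩ := exists_norm_regularPart_le hα hβ hγ θ z 0
  have hs : Summable fun k : ℕ => C * Real.exp (-(k : ℝ)) :=
    Real.summable_exp_neg_nat.mul_left C
  refine Summable.of_norm_bounded hs fun k => ?_
  have hk : (0 : ℝ) ≤ k := k.cast_nonneg
  rw [← neg_one_pow_mul_regularPart hα hβ hθ hz, norm_mul, norm_pow, norm_neg, norm_one, one_pow,
    one_mul]
  have e : (-((k : ℂ) + 1)).re = -((k : ℝ) + 1) := by simp
  refine (h _ (by rw [e]; linarith) (by simp)).trans ?_
  rw [e]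
  gcongr
  linarith

end LeRoy

/-! ### The integral as a sum of residues -/

open LeRoy

theorem mainTheorem11 (α β γ : ℝ) (hα : 0 < α) (hβ : 0 < β) (hγ : 0 < γ)
    (z : ℂ) (hz : z ≠ 0)
    (θ : ℝ) (hθ : (‖z‖ : ℂ) * Complex.exp (Complex.I * θ) = -z)
    (φ₁ φ₂ c : ℝ) (hφ₁ : φ₁ < 0) (hφ₂ : 0 < φ₂) (hc₁ : -1 < c) (hc₂ : c < 0)
    (L : LeRoy.LeftLoop φ₁ φ₂ c) :
    (∃ I : ℂ, L.HasIntegral (LeRoy.integrand α β γ θ z) I) ∧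
      Summable (fun k : ℕ =>
        1 / ((Real.Gamma (α * ((k : ℝ) + 1) + β) ^ γ : ℝ) : ℂ) * (1 / z ^ (k + 1))) ∧
      LeRoy.extended L α β γ θ z =
        -∑' k : ℕ, 1 / ((Real.Gamma (α * ((k : ℝ) + 1) + β) ^ γ : ℝ) : ℂ) * (1 / z ^ (k + 1)) := by
  have hsum := summable_terms (γ := γ) hα hβ hγ hθ hz
  set a : ℕ → ℂ := fun k =>
    1 / ((Real.Gamma (α * ((k : ℝ) + 1) + β) ^ γ : ℝ) : ℂ) * (1 / z ^ (k + 1)) with ha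
  set f := integrand α β γ θ z with hf
  have hfd : ∀ n : ℕ, DifferentiableOn ℂ f (slitDomain (-n - 1) (-n)) :=
    differentiableOn_integrand hα hβ
  -- `F n` is a primitive of the integrand through the gap between `-n - 1` and `-n`.
  choose F hF using fun n : ℕ => exists_primitive_slitDomain (by linarith) (hfd n)
  have hdom : ∀ n : ℕ, slitDomain (-n - 2) (-n - 1) =
      slitDomain (-((n + 1 : ℕ) : ℝ) - 1) (-((n + 1 : ℕ) : ℝ)) := fun n => by
    push_cast
    congr 1 <;> ring
  -- Moving the crossing point of the real line past the first `N` poles.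
  have hcross : ∀ p q : ℂ, 0 < p.im → q.im < 0 → ∀ N : ℕ, F 0 p - F 0 q =
      F N p - F N q + 2 * Real.pi * Complex.I * -∑ k ∈ Finset.range N, a k := by
    intro p q hp hq N
    induction N with
    | zero => simp
    | succ n ih =>
      have h := primitive_jump (γ := γ) (θ := θ) (z := z) (n := n) hα hβ (hF n)
        (F₁ := F (n + 1)) (fun s hs => hF (n + 1) s (hdom n ▸ hs)) hp hq
      rw [neg_one_pow_mul_regularPart hα hβ hθ hz] at h
      rw [ih, h, Finset.sum_range_succ]
      ring
  -- The loop need not be horizontal near its ends, so the limit is taken along any curve.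
  have hlimit : ∀ φ : ℝ, φ ≠ 0 → ∃ l : ℂ, ∀ {ι : Type} (𝓕 : Filter ι) (p : ι → ℂ),
      Tendsto (fun i => (p i).re) 𝓕 atBot → Tendsto (fun i => (p i).im) 𝓕 (𝓝 φ) →
      Tendsto (fun i => F 0 (p i)) 𝓕 (𝓝 l) := by
    intro φ hφ
    have hφ' : 0 < |φ| := abs_pos.mpr hφ
    obtain ⟨C, hC, hb⟩ := exists_norm_integrand_le_of_im hα hβ hγ θ z (half_pos hφ') (2 * |φ|)
    have hstrip : ∀ y ∈ Set.Icc (φ - |φ| / 2) (φ + |φ| / 2), |φ| / 2 ≤ |y| ∧ |y| ≤ 2 * |φ| := by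
      intro y hy
      have h1 : |y - φ| ≤ |φ| / 2 := abs_le.mpr ⟨by linarith [hy.1], by linarith [hy.2]⟩
      have h2 := abs_sub_abs_le_abs_sub φ y
      have h3 := abs_sub_abs_le_abs_sub y φ
      rw [abs_sub_comm] at h2
      constructor <;> linarith
    obtain ⟨l, hl⟩ := exists_tendsto_of_norm_le_exp (F := F 0) (f := f) hC.le
      (fun s _ hs => hF 0 s (Or.inl fun h0 => by
        have := (hstrip _ hs).1
        rw [h0, abs_zero] at this
        linarith))
      (fun s h0 hs => hb s h0 (hstrip _ hs).1 (hstrip _ hs).2)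
    refine ⟨l, fun 𝓕 p hre him => hl.comp (tendsto_inf.mpr ⟨tendsto_comap_iff.mpr hre, ?_⟩)⟩
    exact tendsto_principal.mpr (him.eventually (Icc_mem_nhds (by linarith) (by linarith)))
  obtain ⟨l₁, hl₁⟩ := hlimit φ₁ hφ₁.ne
  obtain ⟨l₂, hl₂⟩ := hlimit φ₂ hφ₂.ne'
  -- The value of `l₂ - l₁`, computed along the lines `re s = -N - 1/2` half way between poles.
  have hvalue : l₂ - l₁ = 2 * Real.pi * Complex.I * -∑' k, a k := by
    set P : ℝ → ℕ → ℂ := fun φ N => ((-(N : ℝ) - 1 / 2 : ℝ) : ℂ) + φ * Complex.I with hP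
    have hPre : ∀ φ N, (P φ N).re = -(N : ℝ) - 1 / 2 := fun φ N => by
      simp only [hP, Complex.add_re, Complex.ofReal_re, Complex.re_ofReal_mul, Complex.I_re,
        mul_zero, add_zero]
    have hPim : ∀ φ N, (P φ N).im = φ := fun φ N => by
      simp only [hP, Complex.add_im, Complex.ofReal_im, Complex.im_ofReal_mul, Complex.I_im,
        mul_one, zero_add]
    have hPlim : ∀ φ, Tendsto (fun N => (P φ N).re) atTop atBot := fun φ => by
      simp only [hPre]
      exact tendsto_atBot_add_const_right _ _
        (tendsto_neg_atTop_atBot.comp tendsto_natCast_atTop_atTop)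
    have hPlim' : ∀ φ, Tendsto (fun N => (P φ N).im) atTop (𝓝 φ) := fun φ => by
      simp only [hPim]
      exact tendsto_const_nhds
    obtain ⟨C, hC, hb⟩ := exists_norm_integrand_le_of_re hα hβ hγ θ z (max |φ₁| |φ₂|)
    have hsmall : Tendsto (fun N => F N (P φ₂ N) - F N (P φ₁ N)) atTop (𝓝 0) := by
      refine squeeze_zero_norm (a := fun N : ℕ => C * Real.exp (-(N : ℝ)) * (φ₂ - φ₁))
        (fun N => ?_) ?_
      · have hconv : Convex ℝ ({-(N : ℝ) - 1 / 2} ×ℂ Set.Icc φ₁ φ₂) :=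
          convex_reProdIm (convex_singleton _) (convex_Icc _ _)
        have h := hconv.norm_image_sub_le_of_norm_hasDerivWithin_le (f := F N) (f' := f)
          (C := C * Real.exp (-(N : ℝ))) (x := P φ₁ N) (y := P φ₂ N)
          (fun s hs => (hF N s (Or.inr (by
            rw [show s.re = _ from hs.1]
            constructor <;> linarith))).hasDerivWithinAt)
          (fun s hs => hb N s hs.1 (abs_le_max_abs_abs hs.2.1 hs.2.2))
          ⟨hPre _ _, by rw [Set.mem_preimage, hPim]; exact ⟨le_rfl, by linarith⟩⟩
          ⟨hPre _ _, by rw [Set.mem_preimage, hPim]; exact ⟨by linarith, le_rfl⟩⟩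
        refine h.trans_eq ?_
        simp only [hP]
        rw [add_sub_add_left_eq_sub, ← sub_mul, ← Complex.ofReal_sub, norm_mul, Complex.norm_I,
          mul_one, Complex.norm_real, Real.norm_of_nonneg (by linarith)]
      · have h := Real.tendsto_exp_neg_atTop_nhds_zero.comp
          (tendsto_natCast_atTop_atTop (R := ℝ))
        simpa using (h.const_mul C).mul_const (φ₂ - φ₁)
    have h1 : Tendsto (fun N => F 0 (P φ₂ N) - F 0 (P φ₁ N)) atTop (𝓝 (l₂ - l₁)) :=
      (hl₂ _ _ (hPlim φ₂) (hPlim' φ₂)).sub (hl₁ _ _ (hPlim φ₁) (hPlim' φ₁))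
    have h2 := hsmall.add ((hsum.hasSum.tendsto_sum_nat.neg).const_mul (2 * Real.pi * Complex.I))
    rw [zero_add] at h2
    refine tendsto_nhds_unique h1 (h2.congr fun N => ?_)
    exact (hcross _ _ (by rwa [hPim]) (by rwa [hPim]) N).symm
  have hc0 : -((0 : ℕ) : ℝ) - 1 < c := by simpa using hc₁
  have hc0' : c < -((0 : ℕ) : ℝ) := by simpa using hc₂
  have hint : L.HasIntegral f (l₂ - l₁) := by
    refine ⟨L.intervalIntegrable_pullback hc0 hc0' (hfd 0).continuousOn, ?_⟩
    simp only [L.integral_pullback hc0 hc0' (hfd 0).continuousOn (hF 0)]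
    exact ((hl₂ _ _ L.re_end L.im_end).comp tendsto_snd).sub
      ((hl₁ _ _ L.re_start L.im_start).comp tendsto_fst)
  refine ⟨⟨_, hint⟩, hsum, ?_⟩
  rw [extended, LeftLoop.integral, hint.2.limUnder_eq, hvalue]
  have h2pi : (2 * Real.pi * Complex.I : ℂ) ≠ 0 := Complex.two_pi_I_ne_zero
  rw [one_div, inv_mul_cancel_left₀ h2pi]
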